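/- For a real $p\times q$ matrix $M$, let $\mathcal{Q}(M)\subseteq\mathbb{R}^{p\times q}$ be its qualitative class, i.e. the set of all real matrices $X$ with the same sign pattern as $M$ ($M_{ij}>0\Rightarrow X_{ij}>0$, $M_{ij}<0\Rightarrow X_{ij}<0$, $M_{ij}=0\Rightarrow X_{ij}=0$), and let $\mathcal{Q}_0(M)$ be the closure of $\mathcal{Q}(M)$. A real square matrix is a $P_0$-matrix if all of its principal minors are nonnegative, and it is positive semistable if all of its complex eigenvalues have nonnegative real part. For a real $n\times n$ matrix $M$, the second additive compound $M^{[2]}$ is the $\binom n2\times\binom n2$ matrix, in the standard basis $\{e_i\wedge e_j : 1\le i<j\le n\}$, of the linear map $\Lambda^2\mathbb{R}^n\to\Lambda^2\mathbb{R}^n$ given by $u\wedge v\mapsto Mu\wedge v+u\wedge Mv$ (for $n\le 1$ it is the empty matrix and every assertion about its principal minors is void). **Proposition.** Let $A$ be an $n\times m$ matrix all of whose entries belong to $\{0,1,-1\}$. (i) If each column of $A$ has at most two nonzero entries then, for every $B\in\mathcal{Q}_0(A^t)$, both $AB$ and $(AB)^{[2]}$ are $P_0$-matrices, and $AB$ is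 positive semistable. (ii) If each row of $A$ has at most two nonzero entries then, for every $B\in\mathcal{Q}_0(A^t)$, $AB$ is positive semistable. -/

import Mathlib

/-- The qualitative class `𝒬(M)`: all real matrices with the same sign pattern as `M`. -/
def qualitativeClass {ι κ : Type*} (M : Matrix ι κ ℝ) : Set (Matrix ι κ ℝ) :=
  {X | ∀ i j, (0 < M i j → 0 < X i j) ∧ (M i j < 0 → X i j < 0) ∧ (M i j = 0 → X i j = 0)}

/-- `𝒬₀(M)`: the closure of the qualitative class `𝒬(M)` in the space of matrices. -/
def closedQualitativeClass {ι κ : Type*} (M : Matrix ι κ ℝ) : Set (Matrix ι κ ℝ) :=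
  closure (qualitativeClass M)

/-- A real square matrix is a `P₀`-matrix if all of its principal minors are nonnegative. -/
def IsPZeroMatrix {ι : Type*} [DecidableEq ι] (M : Matrix ι ι ℝ) : Prop :=
  ∀ α : Finset ι, α.Nonempty →
    0 ≤ (M.submatrix (Subtype.val : α → ι) (Subtype.val : α → ι)).det

/-- A real square matrix is positive semistable if all of its complex eigenvalues lie in the
closed right half-plane. -/
def IsPositiveSemistable {ι : Type*} [Fintype ι] [DecidableEq ι] (M : Matrix ι ι ℝ) : Prop :=
  ∀ z ∈ spectrum ℂ (M.map (fun x : ℝ => (x : ℂ))), 0 ≤ z.re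

/-- The alternating map `(u₁, …, u_k) ↦ ∑ᵢ u₁ ∧ ⋯ ∧ f uᵢ ∧ ⋯ ∧ u_k`. -/
noncomputable def additiveCompoundAlternating {V : Type*} [AddCommGroup V] [Module ℝ V] (k : ℕ)
    (f : V →ₗ[ℝ] V) : V [⋀^Fin k]→ₗ[ℝ] (⋀[ℝ]^k V) where
  toMultilinearMap := ∑ i : Fin k,
    (exteriorPower.ιMulti ℝ k (M := V)).toMultilinearMap.compLinearMap
      (Function.update (fun _ => LinearMap.id) i f)
  map_eq_zero_of_eq' := by
    intro v i j hv hij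
    change (∑ l : Fin k, (exteriorPower.ιMulti ℝ k (M := V)).toMultilinearMap.compLinearMap
      (Function.update (fun _ => LinearMap.id) l f)) v = 0
    rw [_root_.sum_apply, Finset.sum_eq_add i j hij]
    · simp only [MultilinearMap.compLinearMap_apply, AlternatingMap.coe_multilinearMap]
      rw [← AlternatingMap.map_add_swap (exteriorPower.ιMulti ℝ k (M := V))
        (fun l => (Function.update (fun _ => LinearMap.id) i f : Fin k → V →ₗ[ℝ] V) l (v l)) hij]
      congr 2
      funext l
      by_cases hi : l = i
      · subst hi
        simp [hv, hij, hij.symm]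
      · by_cases hj : l = j
        · subst hj
          simp [hv]
        · simp [Equiv.swap_apply_of_ne_of_ne hi hj, hi, hj]
    · intro l _ hl
      simp only [MultilinearMap.compLinearMap_apply, AlternatingMap.coe_multilinearMap]
      refine AlternatingMap.map_eq_zero_of_eq _ _ (i := i) (j := j) ?_ hij
      simp [Function.update_of_ne hl.1.symm, Function.update_of_ne hl.2.symm, hv]
    · intro h
      exact absurd (Finset.mem_univ _) h
    · intro h
      exact absurd (Finset.mem_univ _) h

/-- The `k`-th additive compound of a linear endomorphism `f` of `V`, the endomorphism of `Λᵏ V`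
with `u₁ ∧ ⋯ ∧ u_k ↦ ∑ᵢ u₁ ∧ ⋯ ∧ f uᵢ ∧ ⋯ ∧ u_k`. -/
noncomputable def additiveCompoundMap {V : Type*} [AddCommGroup V] [Module ℝ V] (k : ℕ)
    (f : V →ₗ[ℝ] V) : (⋀[ℝ]^k V) →ₗ[ℝ] (⋀[ℝ]^k V) :=
  exteriorPower.alternatingMapLinearEquiv (additiveCompoundAlternating k f)

theorem additiveCompoundMap_apply_ιMulti {V : Type*} [AddCommGroup V] [Module ℝ V] (k : ℕ)
    (f : V →ₗ[ℝ] V) (u : Fin k → V) :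
    additiveCompoundMap k f (exteriorPower.ιMulti ℝ k u) =
      ∑ i : Fin k, exteriorPower.ιMulti ℝ k (Function.update u i (f (u i))) := by
  rw [additiveCompoundMap, exteriorPower.alternatingMapLinearEquiv_apply_ιMulti]
  change (∑ l : Fin k, (exteriorPower.ιMulti ℝ k (M := V)).toMultilinearMap.compLinearMap
      (Function.update (fun _ => LinearMap.id) l f)) u = _
  rw [_root_.sum_apply]
  refine Finset.sum_congr rfl fun i _ => ?_
  simp only [MultilinearMap.compLinearMap_apply, AlternatingMap.coe_multilinearMap]
  congr 1
  funext l
  by_cases h : l = i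
  · subst h
    simp
  · simp [h]

/-- The `k`-th additive compound matrix `M^{[k]}`: the matrix of the `k`-th additive compound of
`M` in the standard basis `e_{i₁} ∧ ⋯ ∧ e_{i_k}`, `i₁ < ⋯ < i_k`, of `Λᵏ ℝⁿ`. -/
noncomputable def additiveCompound {n : ℕ} (k : ℕ) (M : Matrix (Fin n) (Fin n) ℝ) :
    Matrix (Set.powersetCard (Fin n) k) (Set.powersetCard (Fin n) k) ℝ :=
  LinearMap.toMatrix ((Pi.basisFun ℝ (Fin n)).exteriorPower k)
    ((Pi.basisFun ℝ (Fin n)).exteriorPower k) (additiveCompoundMap k (Matrix.toLin' M))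

/-! Everything reduces to weak column dominance with nonnegative diagonal. If the columns of `A`
have at most two nonzero entries, each ±1, then every term of `(A * B) k k` is `|B j k|`, and the
same number enters at most one other row of column `k`; so `A * B` is dominant. Dominance passes to
principal submatrices and, by a count in the wedge basis, to additive compounds. It forces a
nonnegative determinant (deformation to the identity) and, by Gershgorin, eigenvalues in the closed
right half-plane. When instead rows are sparse, the same argument makes the transpose of `B * A`
dominant, and `A * B` has the same nonzero spectrum as `B * A`. -/

/-- A real square matrix with (weakly) diagonally dominant columns and nonnegative diagonal. -/
def IsColumnDominant {ι : Type*} [Fintype ι] [DecidableEq ι] (M : Matrix ι ι ℝ) : Prop :=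
  ∀ k, ∑ i ∈ Finset.univ.erase k, |M i k| ≤ M k k

namespace IsColumnDominant

variable {ι : Type*} [Fintype ι] [DecidableEq ι] {M : Matrix ι ι ℝ}

theorem diag_nonneg (h : IsColumnDominant M) (k : ι) : 0 ≤ M k k :=
  (Finset.sum_nonneg fun _ _ => abs_nonneg _).trans (h k)

/-- Weak column dominance with nonnegative diagonal forces a nonnegative determinant: the segment
from `M` to the identity consists, apart from `M` itself, of nonsingular matrices. -/
theorem det_nonneg (h : IsColumnDominant M) : 0 ≤ M.det := by
  by_contra! hneg
  let N : ℝ → Matrix ι ι ℝ := fun s => (1 - s) • M + s • (1 : Matrix ι ι ℝ)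
  have hcont : Continuous fun s => (N s).det := by
    refine Continuous.matrix_det ?_
    fun_prop
  have h0 : (N 0).det = M.det := by simp [N]
  have h1 : (N 1).det = 1 := by simp [N]
  obtain ⟨s, ⟨hs0, hs1⟩, hs⟩ := intermediate_value_Icc (zero_le_one' ℝ) hcont.continuousOn
    (show (0 : ℝ) ∈ Set.Icc (N 0).det (N 1).det by
      rw [h0, h1]; exact ⟨hneg.le, zero_le_one⟩)
  have hspos : 0 < s := by
    refine lt_of_le_of_ne hs0 ?_
    rintro rfl
    simp only [h0] at hs
    exact hneg.ne hs
  -- For `s > 0` dominance is strict: off-diagonal entries shrink by `1 - s`, while the diagonal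
  -- gains an extra `s`.
  refine det_ne_zero_of_sum_col_lt_diag (A := N s) (fun k => ?_) hs
  have hoff : ∑ i ∈ Finset.univ.erase k, ‖N s i k‖
      = (1 - s) * ∑ i ∈ Finset.univ.erase k, |M i k| := by
    rw [Finset.mul_sum]
    refine Finset.sum_congr rfl fun i hi => ?_
    simp [N, Matrix.one_apply_ne (Finset.ne_of_mem_erase hi),
      abs_of_nonneg (sub_nonneg.2 hs1)]
  have hdiag : N s k k = (1 - s) * M k k + s := by simp [N]
  have hle := mul_le_mul_of_nonneg_left (h k) (sub_nonneg.2 hs1)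
  have hnn := mul_nonneg (sub_nonneg.2 hs1) (h.diag_nonneg k)
  rw [hoff, hdiag, Real.norm_eq_abs, abs_of_nonneg (by linarith)]
  linarith

theorem submatrix (h : IsColumnDominant M) {κ : Type*} [Fintype κ] [DecidableEq κ] {f : κ → ι}
    (hf : Function.Injective f) : IsColumnDominant (M.submatrix f f) := by
  intro k
  refine le_trans ?_ (h (f k))
  simp only [Matrix.submatrix_apply]
  rw [← Finset.sum_image (f := fun i => |M i (f k)|) hf.injOn]
  refine Finset.sum_le_sum_of_subset_of_nonneg ?_ fun _ _ _ => abs_nonneg _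
  intro i hi
  obtain ⟨l, hl, rfl⟩ := Finset.mem_image.1 hi
  exact Finset.mem_erase.2 ⟨hf.ne (Finset.ne_of_mem_erase hl), Finset.mem_univ _⟩

theorem isPZeroMatrix (h : IsColumnDominant M) : IsPZeroMatrix M :=
  fun _ _ => (h.submatrix Subtype.val_injective).det_nonneg

/-- Gershgorin: if `z.re < 0`, then `|z - M k k| ≥ M k k - z.re > M k k`, so `z - M` is strictly
column dominant, hence nonsingular. -/
theorem isPositiveSemistable (h : IsColumnDominant M) : IsPositiveSemistable M := by
  intro z hz
  by_contra! hre
  rw [spectrum.mem_iff, Matrix.isUnit_iff_isUnit_det, isUnit_iff_ne_zero] at hz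
  refine hz (det_ne_zero_of_sum_col_lt_diag fun k => ?_)
  have hoff : ∑ i ∈ Finset.univ.erase k,
      ‖(algebraMap ℂ (Matrix ι ι ℂ) z - M.map fun x : ℝ => (x : ℂ)) i k‖
      = ∑ i ∈ Finset.univ.erase k, |M i k| := by
    refine Finset.sum_congr rfl fun i hi => ?_
    simp [Matrix.algebraMap_matrix_apply, Finset.ne_of_mem_erase hi]
  rw [hoff]
  refine (h k).trans_lt ?_
  have habs := Complex.abs_re_le_norm
    ((algebraMap ℂ (Matrix ι ι ℂ) z - M.map fun x : ℝ => (x : ℂ)) k k)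
  refine lt_of_lt_of_le ?_ habs
  simp only [Matrix.sub_apply, Matrix.algebraMap_matrix_apply, if_true, Matrix.map_apply,
    Complex.sub_re, Complex.ofReal_re, Algebra.algebraMap_self, RingHom.id_apply]
  rw [abs_sub_comm]
  exact lt_of_lt_of_le (by linarith) (le_abs_self _)

end IsColumnDominant

theorem IsPositiveSemistable.of_transpose {ι : Type*} [Fintype ι] [DecidableEq ι]
    {M : Matrix ι ι ℝ} (h : IsPositiveSemistable M.transpose) : IsPositiveSemistable M := by
  intro z hz
  refine h z ?_
  rw [spectrum.mem_iff, Matrix.isUnit_iff_isUnit_det] at hz ⊢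
  rwa [← Matrix.det_transpose, Matrix.transpose_sub, Matrix.algebraMap_eq_diagonal,
    Matrix.diagonal_transpose, Matrix.transpose_map, Matrix.transpose_transpose,
    ← Matrix.algebraMap_eq_diagonal]

/-- The products `C * D` and `D * C` have the same nonzero eigenvalues. -/
theorem IsPositiveSemistable.mul_comm {ι κ : Type*} [Fintype ι] [DecidableEq ι] [Fintype κ]
    [DecidableEq κ] {C : Matrix ι κ ℝ} {D : Matrix κ ι ℝ} (h : IsPositiveSemistable (D * C)) :
    IsPositiveSemistable (C * D) := by
  intro z hz
  -- The two characteristic polynomials agree up to powers of `X`, which cancel only at `z ≠ 0`; the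
  -- value `0` is harmless anyway.
  rcases eq_or_ne z 0 with rfl | hz0
  · simp
  refine h z ?_
  rw [Matrix.mem_spectrum_iff_isRoot_charpoly, Polynomial.IsRoot.def] at hz ⊢
  change Polynomial.eval z ((C * D).map Complex.ofRealHom).charpoly = 0 at hz
  change Polynomial.eval z ((D * C).map Complex.ofRealHom).charpoly = 0
  rw [Matrix.map_mul] at hz ⊢
  have hcomm := congrArg (Polynomial.eval z) (Matrix.charpoly_mul_comm'
    (C.map Complex.ofRealHom) (D.map Complex.ofRealHom))
  rw [Polynomial.eval_mul, Polynomial.eval_mul, hz, mul_zero] at hcomm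
  refine (mul_eq_zero.1 hcomm.symm).resolve_left ?_
  simp [hz0]

/-! ### Additive compounds in the wedge basis -/

section ExteriorPower

variable {n k : ℕ}

/-- The wedge of `k` standard basis vectors is zero or, up to sign, a standard basis vector. -/
theorem sum_abs_exteriorPower_repr_le_one (v : Fin k → Fin n) :
    ∑ s, |((Pi.basisFun ℝ (Fin n)).exteriorPower k).repr
      (exteriorPower.ιMulti ℝ k fun i => Pi.basisFun ℝ (Fin n) (v i)) s| ≤ 1 := by
  by_cases hv : Function.Injective v
  · let σ := Tuple.sort v
    have hmono : StrictMono (v ∘ σ) :=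
      (Tuple.monotone_sort v).strictMono_of_injective (hv.comp σ.injective)
    let t := Set.powersetCard.ofFinEmbEquiv (OrderEmbedding.ofStrictMono _ hmono)
    have hperm := (exteriorPower.ιMulti ℝ k).map_perm (fun i => Pi.basisFun ℝ (Fin n) (v i)) σ
    have ht : exteriorPower.ιMulti ℝ k ((fun i => Pi.basisFun ℝ (Fin n) (v i)) ∘ σ) =
        (Pi.basisFun ℝ (Fin n)).exteriorPower k t := by
      rw [exteriorPower.basis_apply, exteriorPower.ιMulti_family, Equiv.symm_apply_apply]
      rfl
    rw [ht] at hperm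
    have hsum : ∑ s, |((Pi.basisFun ℝ (Fin n)).exteriorPower k).repr
        ((Pi.basisFun ℝ (Fin n)).exteriorPower k t) s| = 1 := by
      rw [Module.Basis.repr_self, Finset.sum_eq_single t]
      · simp
      · intro s _ hs
        simp [Finsupp.single_eq_of_ne hs]
      · simp
    rcases Int.units_eq_one_or (Equiv.Perm.sign σ) with h | h
    · rw [h, one_smul] at hperm
      rw [← hperm, hsum]
    · rw [h, Units.neg_smul, one_smul] at hperm
      rw [← neg_eq_iff_eq_neg.2 hperm]
      simp only [map_neg, Finsupp.neg_apply, abs_neg]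
      exact hsum.le
  · obtain ⟨i, j, hij, hne⟩ := Function.not_injective_iff.1 hv
    rw [AlternatingMap.map_eq_zero_of_eq _ _ (by rw [hij]) hne]
    simp

/-- Additive compounds inherit column dominance. -/
theorem IsColumnDominant.additiveCompound {M : Matrix (Fin n) (Fin n) ℝ}
    (h : IsColumnDominant M) : IsColumnDominant (additiveCompound k M) := by
  intro t
  set b := (Pi.basisFun ℝ (Fin n)).exteriorPower k with hb
  let e := Set.powersetCard.ofFinEmbEquiv.symm t
  -- `w i l` is the basis wedge `b t` with its `i`-th factor replaced by the `l`-th basis vector.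
  let w : Fin k → Fin n → ⋀[ℝ]^k (Fin n → ℝ) := fun i l =>
    exteriorPower.ιMulti ℝ k fun j => Pi.basisFun ℝ (Fin n) (Function.update e i l j)
  have hw : ∀ i, w i (e i) = b t := by
    intro i
    simp only [w, Function.update_eq_self]
    rw [hb, exteriorPower.basis_apply]
    rfl
  have hval : additiveCompoundMap k (Matrix.toLin' M) (b t) =
      ∑ i, ∑ l, M l (e i) • w i l := by
    rw [hb, exteriorPower.basis_apply, exteriorPower.ιMulti_family,
      additiveCompoundMap_apply_ιMulti]
    refine Finset.sum_congr rfl fun i _ => ?_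
    have hcol : Matrix.toLin' M (Pi.basisFun ℝ (Fin n) (e i)) =
        ∑ l, M l (e i) • Pi.basisFun ℝ (Fin n) l := by
      ext x
      simp [Pi.single_apply]
    have hcomp : ∀ l, Function.update (Pi.basisFun ℝ (Fin n) ∘ e) i (Pi.basisFun ℝ (Fin n) l) =
        fun j => Pi.basisFun ℝ (Fin n) (Function.update e i l j) := by
      intro l
      funext j
      rw [← Function.comp_update]
      rfl
    change exteriorPower.ιMulti ℝ k (Function.update (Pi.basisFun ℝ (Fin n) ∘ e) i
      (Matrix.toLin' M (Pi.basisFun ℝ (Fin n) (e i)))) = _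
    rw [hcol, AlternatingMap.map_update_sum]
    refine Finset.sum_congr rfl fun l _ => ?_
    rw [AlternatingMap.map_update_smul, hcomp]
  have hentry : ∀ s, _root_.additiveCompound k M s t =
      (∑ i, M (e i) (e i)) * b.repr (b t) s +
        ∑ i, ∑ l ∈ Finset.univ.erase (e i), M l (e i) * b.repr (w i l) s := by
    intro s
    rw [_root_.additiveCompound, LinearMap.toMatrix_apply, ← hb, hval, Finset.sum_mul,
      ← Finset.sum_add_distrib]
    simp only [map_sum, map_smul, Finsupp.coe_finsetSum, Finset.sum_apply, Finsupp.smul_apply,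
      smul_eq_mul]
    refine Finset.sum_congr rfl fun i _ => ?_
    rw [← Finset.add_sum_erase _ _ (Finset.mem_univ (e i)), hw]
  -- The part of column `t` that comes from off-diagonal entries of `M`.
  let R : Set.powersetCard (Fin n) k → ℝ := fun s =>
    ∑ i, ∑ l ∈ Finset.univ.erase (e i), M l (e i) * b.repr (w i l) s
  have hR : ∑ s, |R s| ≤ ∑ i, M (e i) (e i) := by
    calc ∑ s, |R s|
        ≤ ∑ s, ∑ i, ∑ l ∈ Finset.univ.erase (e i), |M l (e i)| * |b.repr (w i l) s| := by
          refine Finset.sum_le_sum fun s _ => ?_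
          refine (Finset.abs_sum_le_sum_abs _ _).trans (Finset.sum_le_sum fun i _ => ?_)
          refine (Finset.abs_sum_le_sum_abs _ _).trans (Finset.sum_le_sum fun l _ => ?_)
          rw [abs_mul]
      _ = ∑ i, ∑ l ∈ Finset.univ.erase (e i), |M l (e i)| * ∑ s, |b.repr (w i l) s| := by
          rw [Finset.sum_comm]
          refine Finset.sum_congr rfl fun i _ => ?_
          rw [Finset.sum_comm]
          exact Finset.sum_congr rfl fun l _ => (Finset.mul_sum _ _ _).symm
      _ ≤ ∑ i, ∑ l ∈ Finset.univ.erase (e i), |M l (e i)| :=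
          Finset.sum_le_sum fun i _ => Finset.sum_le_sum fun l _ =>
            mul_le_of_le_one_right (abs_nonneg _) (sum_abs_exteriorPower_repr_le_one _)
      _ ≤ ∑ i, M (e i) (e i) := Finset.sum_le_sum fun i _ => h (e i)
  have hdiag : _root_.additiveCompound k M t t = ∑ i, M (e i) (e i) + R t := by
    rw [hentry, Module.Basis.repr_self, Finsupp.single_eq_same, mul_one]
  have hoff : ∑ s ∈ Finset.univ.erase t, |_root_.additiveCompound k M s t| =
      ∑ s ∈ Finset.univ.erase t, |R s| := by
    refine Finset.sum_congr rfl fun s hs => ?_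
    rw [hentry, Module.Basis.repr_self, Finsupp.single_eq_of_ne (Finset.ne_of_mem_erase hs),
      mul_zero, zero_add]
  rw [← Finset.add_sum_erase _ _ (Finset.mem_univ t)] at hR
  rw [hdiag, hoff]
  -- There is no need to know that `R t` vanishes: a negative `R t` lowers the diagonal by no more
  -- than `|R t|`, which `hR` already counts.
  linarith [neg_abs_le (R t)]

end ExteriorPower

/-! ### Sign patterns and dominance of the product -/

/-- Members of `𝒬₀(M)` agree weakly in sign with `M` and vanish where `M` does. -/
theorem mul_nonneg_of_mem_closedQualitativeClass {ι κ : Type*} {M X : Matrix ι κ ℝ}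
    (hX : X ∈ closedQualitativeClass M) (i : ι) (j : κ) :
    0 ≤ M i j * X i j ∧ (M i j = 0 → X i j = 0) := by
  have hcont : Continuous fun Y : Matrix ι κ ℝ => Y i j := by fun_prop
  have hclosed : IsClosed {Y : Matrix ι κ ℝ | 0 ≤ M i j * Y i j ∧ (M i j = 0 → Y i j = 0)} := by
    have hzero : IsClosed {Y : Matrix ι κ ℝ | M i j = 0 → Y i j = 0} := by
      by_cases h : M i j = 0
      · simpa only [h, forall_const] using isClosed_eq hcont continuous_const
      · simp [h]
    exact (isClosed_le continuous_const (continuous_const.mul hcont)).inter hzero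
  refine closure_minimal ?_ hclosed hX
  intro Y hY
  obtain ⟨hp, hn, hz⟩ := hY i j
  refine ⟨?_, hz⟩
  rcases lt_trichotomy (M i j) 0 with h | h | h
  · exact (mul_pos_of_neg_of_neg h (hn h)).le
  · simp [h]
  · exact (mul_pos h (hp h)).le

/-- If the columns of a `{0, 1, -1}`-matrix `A` have at most two nonzero entries, and `B` agrees
weakly in sign with `Aᵀ`, then `A * B` is column dominant. -/
theorem isColumnDominant_mul {ι κ : Type*} [Fintype ι] [DecidableEq ι] [Fintype κ]
    {A : Matrix ι κ ℝ} {B : Matrix κ ι ℝ} (hA : ∀ i j, A i j = 0 ∨ A i j = 1 ∨ A i j = -1)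
    (hcol : ∀ j, {i | A i j ≠ 0}.ncard ≤ 2)
    (hB : ∀ i j, 0 ≤ A i j * B j i ∧ (A i j = 0 → B j i = 0)) : IsColumnDominant (A * B) := by
  intro k
  have habs : ∀ j, A k j * B j k = |B j k| := by
    intro j
    obtain ⟨h0, hz⟩ := hB k j
    rcases hA k j with h | h | h
    · simp [hz h]
    · rw [h, one_mul] at h0 ⊢
      exact (abs_of_nonneg h0).symm
    · rw [h, neg_one_mul] at h0 ⊢
      exact (abs_of_nonpos (by linarith)).symm
  -- Row `k` uses one of the two nonzero entries allowed in column `j`, leaving at most one, of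
  -- modulus 1.
  have hcolsum : ∀ j, A k j ≠ 0 → ∑ i ∈ Finset.univ.erase k, |A i j| ≤ 1 := by
    intro j hkj
    have hind : ∀ i, |A i j| = if A i j ≠ 0 then 1 else 0 := by
      intro i
      rcases hA i j with h | h | h <;> simp [h]
    have hcard := hcol j
    rw [Set.ncard_eq_toFinset_card', Set.toFinset_ofPred, Finset.card_filter] at hcard
    have htot : ∑ i, |A i j| ≤ 2 := by
      simp_rw [hind]
      exact_mod_cast hcard
    rw [← Finset.add_sum_erase _ _ (Finset.mem_univ k), hind k, if_pos hkj] at htot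
    linarith
  simp only [Matrix.mul_apply]
  calc ∑ i ∈ Finset.univ.erase k, |∑ j, A i j * B j k|
      ≤ ∑ i ∈ Finset.univ.erase k, ∑ j, |A i j| * |B j k| :=
        Finset.sum_le_sum fun i _ => (Finset.abs_sum_le_sum_abs _ _).trans
          (Finset.sum_le_sum fun j _ => (abs_mul _ _).le)
    _ = ∑ j, (∑ i ∈ Finset.univ.erase k, |A i j|) * |B j k| := by
        rw [Finset.sum_comm]
        exact Finset.sum_congr rfl fun j _ => (Finset.sum_mul _ _ _).symm
    _ ≤ ∑ j, A k j * B j k := by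
        refine Finset.sum_le_sum fun j _ => ?_
        rw [habs]
        by_cases hkj : A k j = 0
        · simp [(hB k j).2 hkj]
        · exact mul_le_of_le_one_left (abs_nonneg _) (hcolsum j hkj)

theorem mainTheorem6 (n m : ℕ) (A : Matrix (Fin n) (Fin m) ℝ)
    (hA : ∀ i j, A i j = 0 ∨ A i j = 1 ∨ A i j = -1) :
    ((∀ j, {i | A i j ≠ 0}.ncard ≤ 2) →
      ∀ B ∈ closedQualitativeClass A.transpose,
        IsPZeroMatrix (A * B) ∧ IsPZeroMatrix (additiveCompound 2 (A * B)) ∧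
          IsPositiveSemistable (A * B)) ∧
    ((∀ i, {j | A i j ≠ 0}.ncard ≤ 2) →
      ∀ B ∈ closedQualitativeClass A.transpose, IsPositiveSemistable (A * B)) := by
  refine ⟨fun hcol B hB => ?_, fun hrow B hB => ?_⟩
  · have hdom : IsColumnDominant (A * B) := isColumnDominant_mul hA hcol fun i j =>
      mul_nonneg_of_mem_closedQualitativeClass hB j i
    exact ⟨hdom.isPZeroMatrix, hdom.additiveCompound.isPZeroMatrix, hdom.isPositiveSemistable⟩
  -- This controls `B * A`, so only spectral information carries over to `A * B`.
  · have hdom : IsColumnDominant (A.transpose * B.transpose) :=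
      isColumnDominant_mul (fun j i => hA i j) hrow fun j i =>
        mul_nonneg_of_mem_closedQualitativeClass hB j i
    rw [← Matrix.transpose_mul] at hdom
    exact hdom.isPositiveSemistable.of_transpose.mul_comm
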